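/- Order $\omega^\omega$ coordinatewise. For $\alpha\in\omega^\omega$ and $k\in\omega$ let $\alpha|k\in\omega^k$ be the restriction of $\alpha$ to its first $k$ values; for $\beta\in\omega^n\subset\omega^{<\omega}=\bigcup_{n\in\omega}\omega^n$ let ${\uparrow}\beta=\{\alpha\in\omega^\omega:\alpha|n=\beta\}$, and for a family of sets $(U_\alpha)_{\alpha\in\omega^\omega}$ put $U_\beta=U_{{\uparrow}\beta}=\bigcap_{\alpha\in{\uparrow}\beta}U_\alpha$. Let $X$ be a topological space (neighborhoods need not be open). A sequence $(x_n)_{n\in\omega}$ in $X$ accumulates at $x$ if every neighborhood of $x$ contains $x_n$ for infinitely many $n$; a set $C\subset X$ accumulates at $x$ if every neighborhood of $x$ contains infinitely many points of $C$. For a family $\mathcal C$ of subsets of $X$, a family $\mathcal N$ of subsets of $X$ is a $\mathcal C^*$-network at $x$ if for every neighborhood $O_x$ of $x$ and every $C\in\mathcal C$ accumulating at $x$ there is $N\in\mathcal N$ such that $x\in N\subset O_x$ and $N\cap C$ is infinite. Let $\mathsf{css}$ be the family of all countable subsets of $X$ and $\mathsf{as}$ the family of all subsets of $X$. (1) Let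 $x\in X$ and let $(U_\alpha)_{\alpha\in\omega^\omega}$ be a neighborhood $\omega^\omega$-base at $x$, that is, a neighborhood base at $x$ with $U_\beta\subset U_\alpha$ for all $\alpha\le\beta$ in $\omega^\omega$. Then for every $\alpha\in\omega^\omega$ and every sequence $(x_n)_{n\in\omega}$ in $X$ accumulating at $x$ there is $k\in\omega$ such that $x_n\in U_{\alpha|k}$ for infinitely many $n$. Moreover, $\{U_\beta\}_{\beta\in\omega^{<\omega}}$ is a countable $\mathsf{css}^*$-network at $x$. (2) An entourage on $X$ is a subset $E$ of $X\times X$ containing the diagonal, and $E[x]=\{y:(x,y)\in E\}$. An entourage base for $X$ is a family $\mathcal B$ of entourages such that any $B_1,B_2\in\mathcal B$ satisfy $B_3\subset B_1\cap B_2$ for some $B_3\in\mathcal B$, and $\{B[x]:B\in\mathcal B\}$ is a neighborhood base at $x$ for every $x\in X$. A $\mathcal C^*$-netbase for $X$ is a pair $(\mathcal N,\mathcal B)$ of a family $\mathcal N$ of entourages and an entourage base $\mathcal B$ for $X$ such that for all $B\in\mathcal B$ and $x\in X$ the family $\{N[x]:N\in\mathcal N,\ N\subset B\}$ is a $\mathcal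 C^*$-network at $x$; it is countable if $\mathcal N$ is countable. Let $(U_\alpha)_{\alpha\in\omega^\omega}$ be an $\omega^\omega$-base for $X$, that is, a family of entourages with $U_\beta\subset U_\alpha$ for all $\alpha\le\beta$ such that $\{U_\alpha[x]\}_{\alpha\in\omega^\omega}$ is a neighborhood base at $x$ for every $x\in X$. Then $X$ has the strong Pytkeev$^*$ property (it has a countable $\mathsf{css}^*$-network at each point), and the pair $\big(\{U_{{\uparrow}\beta}\}_{\beta\in\omega^{<\omega}},\{U_\alpha\}_{\alpha\in\omega^\omega}\big)$ is a countable $\mathsf{css}^*$-netbase for $X$. If $X$ is countably tight (whenever $x\in\overline A$ there is a countable $B\subset A$ with $x\in\overline B$), then this pair is a countable $\mathsf{as}^*$-netbase for $X$. -/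

import Mathlib

open Set Filter Topology

namespace OmegaBase

/-- `ω^{<ω}`: a finite sequence of natural numbers, given by its length and its entries. -/
abbrev FinSeq : Type := Σ n : ℕ, (Fin n → ℕ)

/-- The restriction `α|k`, the sequence of the first `k` values of `α`. -/
def restr (α : ℕ → ℕ) (k : ℕ) : FinSeq := ⟨k, fun i => α i⟩

/-- `↑β`, the set of all `α ∈ ω^ω` whose restriction to the length of `β` is `β`. -/
def upSet (β : FinSeq) : Set (ℕ → ℕ) := {α | restr α β.1 = β}

/-- `U_β = U_{↑β} = ⋂ {U_α : α ∈ ↑β}`. -/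
def interUp {Y : Type*} (U : (ℕ → ℕ) → Set Y) (β : FinSeq) : Set Y :=
  ⋂ α ∈ upSet β, U α

/-- `(U_α)` is a neighborhood `ω^ω`-base at `x`: a neighborhood base at `x` (of not necessarily
open neighborhoods) with `U_β ⊆ U_α` whenever `α ≤ β` coordinatewise. -/
structure IsNhdsOmegaBase {X : Type*} [TopologicalSpace X] (x : X)
    (U : (ℕ → ℕ) → Set X) : Prop where
  mem_nhds : ∀ α, U α ∈ 𝓝 x
  exists_subset : ∀ O ∈ 𝓝 x, ∃ α, U α ⊆ O
  mono : ∀ α β : ℕ → ℕ, α ≤ β → U β ⊆ U α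

/-- The ball `E[x] = {y : (x, y) ∈ E}`. -/
def eball {X : Type*} (E : Set (X × X)) (x : X) : Set X := {y | (x, y) ∈ E}

/-- An entourage: a subset of `X × X` that contains the diagonal. -/
def IsEntourage {X : Type*} (E : Set (X × X)) : Prop := ∀ x, (x, x) ∈ E

/-- `(U_α)` is an `ω^ω`-base for `X`: entourages, `U_β ⊆ U_α` whenever `α ≤ β`, whose balls
at every point `x` form a neighborhood base at `x`. -/
structure IsOmegaBase {X : Type*} [TopologicalSpace X]
    (U : (ℕ → ℕ) → Set (X × X)) : Prop where
  entourage : ∀ α, IsEntourage (U α)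
  mono : ∀ α β : ℕ → ℕ, α ≤ β → U β ⊆ U α
  nhds_base : ∀ x : X, IsNhdsOmegaBase x (fun α => eball (U α) x)

/-- A sequence accumulates at `x`: each neighborhood of `x` contains `x_n` for infinitely
many `n`. -/
def SeqAccumulatesAt {X : Type*} [TopologicalSpace X] (s : ℕ → X) (x : X) : Prop :=
  ∀ O ∈ 𝓝 x, {n | s n ∈ O}.Infinite

/-- A set accumulates at `x`: each neighborhood of `x` contains infinitely many of its points. -/
def SetAccumulatesAt {X : Type*} [TopologicalSpace X] (C : Set X) (x : X) : Prop :=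
  ∀ O ∈ 𝓝 x, (O ∩ C).Infinite

/-- `𝒩` is a `𝒞*`-network at `x`. -/
def IsStarNetworkAt {X : Type*} [TopologicalSpace X] (𝒞 𝒩 : Set (Set X)) (x : X) : Prop :=
  ∀ O ∈ 𝓝 x, ∀ C ∈ 𝒞, SetAccumulatesAt C x →
    ∃ N ∈ 𝒩, x ∈ N ∧ N ⊆ O ∧ (N ∩ C).Infinite

/-- The family of all countable subsets of `X`. -/
def css (X : Type*) : Set (Set X) := {C | C.Countable}

/-- The family of all subsets of `X`. -/
def allSubsets (X : Type*) : Set (Set X) := univ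

/-- The strong Pytkeev* property: a countable `css*`-network at each point. -/
def StrongPytkeevStar (X : Type*) [TopologicalSpace X] : Prop :=
  ∀ x : X, ∃ 𝒩 : Set (Set X), 𝒩.Countable ∧ IsStarNetworkAt (css X) 𝒩 x

/-- An entourage base for the topological space `X`. -/
structure IsEntourageBase {X : Type*} [TopologicalSpace X] (ℬ : Set (Set (X × X))) : Prop where
  entourage : ∀ B ∈ ℬ, IsEntourage B
  directed : ∀ B₁ ∈ ℬ, ∀ B₂ ∈ ℬ, ∃ B₃ ∈ ℬ, B₃ ⊆ B₁ ∩ B₂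
  ball_mem_nhds : ∀ x : X, ∀ B ∈ ℬ, eball B x ∈ 𝓝 x
  exists_ball_subset : ∀ x : X, ∀ O ∈ 𝓝 x, ∃ B ∈ ℬ, eball B x ⊆ O

/-- `(𝒩, ℬ)` is a `𝒞*`-netbase for `X`. -/
structure IsStarNetbase {X : Type*} [TopologicalSpace X] (𝒞 : Set (Set X))
    (𝒩 ℬ : Set (Set (X × X))) : Prop where
  entourage : ∀ N ∈ 𝒩, IsEntourage N
  base : IsEntourageBase ℬ
  network : ∀ B ∈ ℬ, ∀ x : X,
    IsStarNetworkAt 𝒞 {A | ∃ N ∈ 𝒩, N ⊆ B ∧ A = eball N x} x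

/-- `(𝒩, ℬ)` is a countable `𝒞*`-netbase for `X`: a `𝒞*`-netbase with `𝒩` countable. -/
def IsCountableStarNetbase {X : Type*} [TopologicalSpace X] (𝒞 : Set (Set X))
    (𝒩 ℬ : Set (Set (X × X))) : Prop :=
  𝒩.Countable ∧ IsStarNetbase 𝒞 𝒩 ℬ

/-- `X` is countably tight: whenever `x ∈ closure A`, some countable `B ⊆ A` has
`x ∈ closure B`. -/
def CountablyTight (X : Type*) [TopologicalSpace X] : Prop :=
  ∀ (x : X) (A : Set X), x ∈ closure A → ∃ B ⊆ A, B.Countable ∧ x ∈ closure B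

end OmegaBase

namespace OmegaBase

/-! The core is a diagonal argument. If each `U_{α|k}` contained `x_n` for only finitely many `n`,
then almost every `x_n` would avoid some `U_{β_n}`, where `β_n` agrees with `α` on the first `K n`
values and `K n → ∞`. Such `β_n` have a common upper bound `γ`, so by monotonicity `U_γ` misses
almost all `x_n`, contradicting accumulation. Enumerating a countable set injectively turns this
into the network statement; balls commute with the intersections, which gives the netbase. Countable
tightness reduces arbitrary sets to countable ones. -/

theorem mem_upSet_restr {α β : ℕ → ℕ} {k : ℕ} :
    β ∈ upSet (restr α k) ↔ ∀ i < k, β i = α i := by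
  constructor
  · intro h i hi
    have h' : (⟨k, fun i => β i⟩ : FinSeq) = ⟨k, fun i => α i⟩ := h
    exact congrFun (eq_of_heq (Sigma.mk.inj h').2) ⟨i, hi⟩
  · intro h
    have h' : (fun i : Fin k => β i) = fun i : Fin k => α i := funext fun i => h i i.2
    exact congrArg (Sigma.mk k) h'

theorem interUp_restr_subset {Y : Type*} (U : (ℕ → ℕ) → Set Y) (α : ℕ → ℕ) (k : ℕ) :
    interUp U (restr α k) ⊆ U α :=
  biInter_subset_of_mem (mem_upSet_restr.2 fun _ _ => rfl)

theorem mem_interUp {Y : Type*} {U : (ℕ → ℕ) → Set Y} {y : Y} (h : ∀ α, y ∈ U α)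
    (β : FinSeq) : y ∈ interUp U β :=
  mem_iInter₂.2 fun α _ => h α

theorem eball_interUp {X : Type*} (U : (ℕ → ℕ) → Set (X × X)) (β : FinSeq) (x : X) :
    eball (interUp U β) x = interUp (fun α => eball (U α) x) β := by
  ext y
  simp [eball, interUp]

/-- Finite-to-one control of initial segments makes a sequence in `ω^ω` bounded. -/
theorem exists_forall_le_of_agree {α : ℕ → ℕ} {β : ℕ → ℕ → ℕ} {K : ℕ → ℕ}
    (hK : ∀ i, {n | K n ≤ i}.Finite) (hβ : ∀ n, ∀ i < K n, β n i = α i) :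
    ∃ γ, ∀ n, β n ≤ γ := by
  have hbdd : ∀ i, ∃ m, ∀ n, β n i ≤ m := by
    intro i
    obtain ⟨m, hm⟩ := ((hK i).image fun n => β n i).bddAbove
    -- Only the finitely many `n` with `K n ≤ i` may deviate from `α i`; `m` bounds those.
    refine ⟨max m (α i), fun n => ?_⟩
    rcases le_or_gt (K n) i with h | h
    · exact (hm ⟨n, h, rfl⟩).trans (le_max_left _ _)
    · exact (hβ n i h).le.trans (le_max_right _ _)
  choose γ hγ using hbdd
  exact ⟨γ, fun n i => hγ i n⟩

theorem IsNhdsOmegaBase.exists_infinite_mem_interUp {X : Type*} [TopologicalSpace X] {x : X}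
    {U : (ℕ → ℕ) → Set X} (hU : IsNhdsOmegaBase x U) (α : ℕ → ℕ) {s : ℕ → X}
    (hs : SeqAccumulatesAt s x) : ∃ k, {n | s n ∈ interUp U (restr α k)}.Infinite := by
  classical
  by_contra! hfin
  -- The cutoff `n` guarantees a maximum even if `s n` lies in no `U_{α|k}`; it costs only the
  -- indices `n ≤ i` in `hK`.
  let K : ℕ → ℕ := fun n => Nat.findGreatest (fun k => s n ∉ interUp U (restr α k)) n
  have hK : ∀ i, {n | K n ≤ i}.Finite := by
    intro i
    refine ((hfin (i + 1)).union (finite_Iic i)).subset fun n hn => ?_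
    by_contra hnot
    rw [mem_union, not_or, mem_Iic, not_le] at hnot
    exact absurd (Nat.le_findGreatest (P := fun k => s n ∉ interUp U (restr α k))
      hnot.2 hnot.1) (not_le.2 (Nat.lt_succ_of_le hn))
  have hβ : ∀ n, ∃ β : ℕ → ℕ, (∀ i < K n, β i = α i) ∧
      (s n ∉ interUp U (restr α 0) → s n ∉ U β) := by
    intro n
    by_cases h0 : s n ∈ interUp U (restr α 0)
    -- A filler value: by `hfin 0` only finitely many `n` fall here.
    · exact ⟨α, fun _ _ => rfl, fun h => absurd h0 h⟩
    · have h : s n ∉ interUp U (restr α (K n)) :=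
        Nat.findGreatest_spec (P := fun k => s n ∉ interUp U (restr α k)) (Nat.zero_le n) h0
      simp only [interUp, mem_iInter, not_forall] at h
      obtain ⟨β, hβ, hn⟩ := h
      exact ⟨β, mem_upSet_restr.1 hβ, fun _ => hn⟩
  choose β hagree hnot using hβ
  obtain ⟨γ, hγ⟩ := exists_forall_le_of_agree hK hagree
  refine hs (U γ) (hU.mem_nhds γ) ((hfin 0).subset fun n hn => ?_)
  by_contra h0
  exact hnot n h0 (hU.mono _ _ (hγ n) hn)

theorem IsNhdsOmegaBase.exists_infinite_inter {X : Type*} [TopologicalSpace X] {x : X}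
    {U : (ℕ → ℕ) → Set X} (hU : IsNhdsOmegaBase x U) (α : ℕ → ℕ) {C : Set X}
    (hC : C.Countable) (hx : SetAccumulatesAt C x) :
    ∃ k, (interUp U (restr α k) ∩ C).Infinite := by
  have hinf : C.Infinite := by simpa using hx univ univ_mem
  have : Countable C := hC
  have : Infinite C := hinf.to_subtype
  -- With a bijective enumeration, infinitely many indices yield infinitely many distinct points.
  obtain ⟨e⟩ := nonempty_equiv_of_countable (α := ℕ) (β := C)
  obtain ⟨k, hk⟩ := hU.exists_infinite_mem_interUp α (s := fun n => (e n : X)) (by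
    intro O hO hfin
    refine hx O hO ((hfin.image fun n => (e n : X)).subset ?_)
    rintro y ⟨hyO, hyC⟩
    exact ⟨e.symm ⟨y, hyC⟩, by simpa using hyO, by simp⟩)
  refine ⟨k, (hk.image (f := fun n => (e n : X)) ?_).mono ?_⟩
  · exact (Subtype.val_injective.comp e.injective).injOn
  · rintro _ ⟨n, hn, rfl⟩
    exact ⟨hn, (e n).2⟩

theorem IsNhdsOmegaBase.isStarNetworkAt {X : Type*} [TopologicalSpace X] {x : X}
    {U : (ℕ → ℕ) → Set X} (hU : IsNhdsOmegaBase x U) :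
    IsStarNetworkAt (css X) (range (interUp U)) x := by
  intro O hO C hC hx
  obtain ⟨α, hα⟩ := hU.exists_subset O hO
  obtain ⟨k, hk⟩ := hU.exists_infinite_inter α hC hx
  exact ⟨_, ⟨_, rfl⟩, mem_interUp (fun α => mem_of_mem_nhds (hU.mem_nhds α)) _,
    (interUp_restr_subset U α k).trans hα, hk⟩

/-- Tightness only yields closure points, and without T₁ a single point of `C` can lie in every
neighborhood of `x`. If infinitely many do, countably many of them suffice; otherwise they are
discarded before tightness is applied. -/
theorem SetAccumulatesAt.exists_countable {X : Type*} [TopologicalSpace X]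
    (ht : CountablyTight X) {C : Set X} {x : X} (hx : SetAccumulatesAt C x) :
    ∃ B ⊆ C, B.Countable ∧ SetAccumulatesAt B x := by
  let D : Set X := {y ∈ C | ∀ O ∈ 𝓝 x, y ∈ O}
  by_cases hD : D.Infinite
  · obtain ⟨B, hBD, hB, hBinf⟩ : ∃ B ⊆ D, B.Countable ∧ B.Infinite :=
      ⟨range fun n => (hD.natEmbedding D n : X), range_subset_iff.2 fun n => Subtype.coe_prop _,
        countable_range _, infinite_range_of_injective
          (Subtype.val_injective.comp (hD.natEmbedding D).injective)⟩
    refine ⟨B, fun y hy => (hBD hy).1, hB, fun O hO => ?_⟩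
    rwa [inter_eq_right.2 fun y hy => (hBD hy).2 O hO]
  · rw [not_infinite] at hD
    have hcl : x ∈ closure (C \ D) := by
      refine mem_closure_iff_nhds.2 fun O hO => ?_
      obtain ⟨y, hy, hyD⟩ := ((hx O hO).sdiff hD).nonempty
      exact ⟨y, hy.1, hy.2, hyD⟩
    obtain ⟨B, hBC, hB, hxB⟩ := ht x _ hcl
    refine ⟨B, hBC.trans sdiff_subset, hB, fun O hO hfin => ?_⟩
    -- Points outside `D` can be removed from `O` one by one; if `O ∩ B` is finite, the result is a
    -- neighborhood of `x` missing `B`.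
    have hmiss : ∀ y ∈ O ∩ B, {y}ᶜ ∈ 𝓝 x := by
      intro y hy
      by_contra h
      refine (hBC hy.2).2 ⟨(hBC hy.2).1, fun V hV => ?_⟩
      by_contra hyV
      exact h (mem_of_superset hV fun z hz hzy => hyV (hzy ▸ hz))
    obtain ⟨y, ⟨hyO, hyM⟩, hyB⟩ := mem_closure_iff_nhds.1 hxB _
      (inter_mem hO ((biInter_mem hfin).2 hmiss))
    exact mem_iInter₂.1 hyM y ⟨hyO, hyB⟩ rfl

theorem IsStarNetworkAt.of_countablyTight {X : Type*} [TopologicalSpace X]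
    (ht : CountablyTight X) {𝒩 : Set (Set X)} {x : X} (h : IsStarNetworkAt (css X) 𝒩 x) :
    IsStarNetworkAt (allSubsets X) 𝒩 x := by
  intro O hO C _ hx
  obtain ⟨B, hBC, hB, hxB⟩ := hx.exists_countable ht
  obtain ⟨N, hN, hxN, hNO, hNB⟩ := h O hO B hB hxB
  exact ⟨N, hN, hxN, hNO, hNB.mono (inter_subset_inter_right N hBC)⟩

theorem IsOmegaBase.isEntourageBase {X : Type*} [TopologicalSpace X]
    {U : (ℕ → ℕ) → Set (X × X)} (hU : IsOmegaBase U) : IsEntourageBase (range U) where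
  entourage := by
    rintro _ ⟨α, rfl⟩
    exact hU.entourage α
  directed := by
    rintro _ ⟨α, rfl⟩ _ ⟨β, rfl⟩
    exact ⟨_, ⟨α ⊔ β, rfl⟩,
      subset_inter (hU.mono _ _ le_sup_left) (hU.mono _ _ le_sup_right)⟩
  ball_mem_nhds := by
    rintro x _ ⟨α, rfl⟩
    exact (hU.nhds_base x).mem_nhds α
  exists_ball_subset := by
    intro x O hO
    obtain ⟨α, hα⟩ := (hU.nhds_base x).exists_subset O hO
    exact ⟨_, ⟨α, rfl⟩, hα⟩

theorem IsOmegaBase.isStarNetbase {X : Type*} [TopologicalSpace X]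
    {U : (ℕ → ℕ) → Set (X × X)} (hU : IsOmegaBase U) :
    IsStarNetbase (css X) (range (interUp U)) (range U) where
  entourage := by
    rintro _ ⟨β, rfl⟩ x
    exact mem_interUp (fun α => hU.entourage α x) β
  base := hU.isEntourageBase
  network := by
    rintro _ ⟨α, rfl⟩ x O hO C hC hx
    obtain ⟨γ, hγ⟩ := (hU.nhds_base x).exists_subset O hO
    -- The join serves both demands: `α` keeps the entourage inside `U α`, `γ` keeps its ball inside
    -- `O`.
    obtain ⟨k, hk⟩ := (hU.nhds_base x).exists_infinite_inter (α ⊔ γ) hC hx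
    rw [← eball_interUp] at hk
    have hsub := interUp_restr_subset U (α ⊔ γ) k
    exact ⟨_, ⟨_, ⟨_, rfl⟩, hsub.trans (hU.mono _ _ le_sup_left), rfl⟩,
      mem_interUp (fun δ => hU.entourage δ x) _,
      fun y hy => hγ (hU.mono _ _ le_sup_right (hsub hy)), hk⟩

theorem IsStarNetbase.of_countablyTight {X : Type*} [TopologicalSpace X]
    (ht : CountablyTight X) {𝒩 ℬ : Set (Set (X × X))} (h : IsStarNetbase (css X) 𝒩 ℬ) :
    IsStarNetbase (allSubsets X) 𝒩 ℬ where
  entourage := h.entourage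
  base := h.base
  network B hB x := (h.network B hB x).of_countablyTight ht

end OmegaBase

theorem theoremt {X : Type*} [TopologicalSpace X] :
    (∀ (x : X) (U : (ℕ → ℕ) → Set X), OmegaBase.IsNhdsOmegaBase x U →
      (∀ (α : ℕ → ℕ) (s : ℕ → X), OmegaBase.SeqAccumulatesAt s x →
        ∃ k : ℕ, {n | s n ∈ OmegaBase.interUp U (OmegaBase.restr α k)}.Infinite) ∧
      (Set.range (OmegaBase.interUp U)).Countable ∧
      OmegaBase.IsStarNetworkAt (OmegaBase.css X) (Set.range (OmegaBase.interUp U)) x) ∧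
    (∀ U : (ℕ → ℕ) → Set (X × X), OmegaBase.IsOmegaBase U →
      OmegaBase.StrongPytkeevStar X ∧
      OmegaBase.IsCountableStarNetbase (OmegaBase.css X)
        (Set.range (OmegaBase.interUp U)) (Set.range U) ∧
      (OmegaBase.CountablyTight X →
        OmegaBase.IsCountableStarNetbase (OmegaBase.allSubsets X)
          (Set.range (OmegaBase.interUp U)) (Set.range U))) := by
  refine ⟨fun x U hU => ⟨fun α s hs => hU.exists_infinite_mem_interUp α hs,
    countable_range _, hU.isStarNetworkAt⟩, fun U hU => ⟨fun x => ?_, ?_, fun ht => ?_⟩⟩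
  · exact ⟨_, countable_range _, (hU.nhds_base x).isStarNetworkAt⟩
  · exact ⟨countable_range _, hU.isStarNetbase⟩
  · exact ⟨countable_range _, hU.isStarNetbase.of_countablyTight ht⟩
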